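/- Let $d\ge 0$ and let $K\in L^2(\mathbf{R}^d\times\mathbf{R}^d)$ be a real-valued kernel that is symmetric, i.e. $K(x,y)=K(y,x)$ for almost every $(x,y)$. Let $T=T_K$ be the (self-adjoint, Hilbert–Schmidt) integral operator $(Tf)(x)=\int_{\mathbf{R}^d}K(x,y)f(y)\,dy$ on $L^2(\mathbf{R}^d)$, and let $|T|=(T^*T)^{1/2}$ be its absolute value, i.e. the unique bounded operator with $|T|\ge 0$ and $|T|^2=T^2$. For $s>0$ let $H^s(\mathbf{R}^{d}\times\mathbf{R}^d)$ be the Sobolev space of tempered distributions $\varphi$ on $\mathbf{R}^{2d}$ with $\|\varphi\|_{H^s}^2=\int_{\mathbf{R}^{2d}}(1+|\zeta|^2)^s|\widehat\varphi(\zeta)|^2\,d\zeta<\infty$, where $\widehat\varphi(\zeta)=\int e^{-2\pi i\zeta\cdot z}\varphi(z)\,dz$ for Schwartz functions $\varphi$. For every $s>0$ there is a constant $C<\infty$, depending only on $s$, such that the following holds for all such $d$ and $K$: if $K\in H^s(\mathbf{R}^d\times\mathbf{R}^d)$, then $|T|$ is an integral operator with a real-valued symmetric kernel $K_{|T|}\in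 L^2(\mathbf{R}^d\times\mathbf{R}^d)$, and $K_{|T|}\in H^s(\mathbf{R}^d\times\mathbf{R}^d)$ with $$\|K_{|T|}\|_{H^s}\le C\,\|K\|_{H^s}\qquad\text{and}\qquad \|K\|_{H^s}\le C\,\|K_{|T|}\|_{H^s}.$$ -/

import Mathlib

open MeasureTheory
open scoped ENNReal NNReal FourierTransform SchwartzMap TemperedDistribution

noncomputable section

/-- The Euclidean space `ℝ^d`. -/
abbrev Euc (d : ℕ) : Type := EuclideanSpace ℝ (Fin d)

/-- The Hilbert space `L²(ℝ^d)` (complex-valued functions). -/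
abbrev L2 (d : ℕ) : Type := Lp ℂ 2 (volume : Measure (Euc d))

/-- The space `ℝ^d × ℝ^d` with its Euclidean norm `‖(x, y)‖² = ‖x‖² + ‖y‖²` (and Lebesgue
measure), on which Fourier transforms and Sobolev norms of kernels are taken. -/
abbrev EucProd (d : ℕ) : Type := WithLp 2 (Euc d × Euc d)

/-! ### The integral operator of a square-integrable kernel -/

/-- Cauchy-Schwarz in the inner variable, then integration in the outer variable. -/
theorem eLpNorm_integral_kernel_le {d : ℕ} {K : Euc d × Euc d → ℝ} (hK : MemLp K 2 volume)
    {f : Euc d → ℂ} (hf : MemLp f 2 volume) :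
    eLpNorm (fun x => ∫ y, (K (x, y) : ℂ) * f y) 2 volume
      ≤ eLpNorm K 2 volume * eLpNorm f 2 volume := by
  have hKm : AEMeasurable (fun z => ‖K z‖ₑ) (volume.prod volume : Measure (Euc d × Euc d)) :=
    hK.1.enorm
  have key : ∀ᵐ x : Euc d, ‖∫ y, (K (x, y) : ℂ) * f y‖ₑ ^ (2 : ℝ)
      ≤ (∫⁻ y, ‖K (x, y)‖ₑ ^ (2 : ℝ)) * ∫⁻ y, ‖f y‖ₑ ^ (2 : ℝ) := by
    filter_upwards [hK.1.prodMk_left] with x hx'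
    have hx := hx'.enorm
    have h1 : ‖∫ y, (K (x, y) : ℂ) * f y‖ₑ ≤ ∫⁻ y, ‖K (x, y)‖ₑ * ‖f y‖ₑ := by
      refine (enorm_integral_le_lintegral_enorm _).trans (le_of_eq ?_)
      refine lintegral_congr fun y => ?_
      rw [enorm_mul]
      congr 1
      simp [enorm, nnnorm]
    have h2 := ENNReal.lintegral_mul_le_Lp_mul_Lq volume Real.HolderConjugate.two_two hx
      hf.1.enorm
    calc ‖∫ y, (K (x, y) : ℂ) * f y‖ₑ ^ (2 : ℝ)
        ≤ ((∫⁻ y, ‖K (x, y)‖ₑ ^ (2 : ℝ)) ^ (1 / 2 : ℝ)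
            * (∫⁻ y, ‖f y‖ₑ ^ (2 : ℝ)) ^ (1 / 2 : ℝ)) ^ (2 : ℝ) := by
          gcongr
          exact h1.trans h2
      _ = _ := by
          rw [ENNReal.mul_rpow_of_nonneg _ _ (by norm_num), ← ENNReal.rpow_mul,
            ← ENNReal.rpow_mul]
          norm_num
  rw [eLpNorm_eq_lintegral_rpow_enorm_toReal (by norm_num) (by norm_num),
    eLpNorm_eq_lintegral_rpow_enorm_toReal (by norm_num) (by norm_num),
    eLpNorm_eq_lintegral_rpow_enorm_toReal (by norm_num) (by norm_num),
    ← ENNReal.mul_rpow_of_nonneg _ _ (by norm_num)]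
  simp only [ENNReal.toReal_ofNat]
  gcongr ?_ ^ _
  refine (lintegral_mono_ae key).trans (le_of_eq ?_)
  have hfin : ∫⁻ y, ‖f y‖ₑ ^ (2 : ℝ) ≠ ∞ := by
    have := lintegral_rpow_enorm_lt_top_of_eLpNorm_lt_top (by norm_num) (by norm_num) hf.2
    simpa using this.ne
  rw [lintegral_mul_const' _ _ hfin, Measure.volume_eq_prod,
    lintegral_prod _ (hKm.pow_const _)]

theorem memLp_integral_kernel {d : ℕ} {K : Euc d × Euc d → ℝ} (hK : MemLp K 2 volume)
    {f : Euc d → ℂ} (hf : MemLp f 2 volume) :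
    MemLp (fun x => ∫ y, (K (x, y) : ℂ) * f y) 2 volume := by
  refine ⟨?_, (eLpNorm_integral_kernel_le hK hf).trans_lt (ENNReal.mul_lt_top hK.2 hf.2)⟩
  have h : AEStronglyMeasurable (fun z : Euc d × Euc d => (K z : ℂ) * f z.2)
      (volume.prod volume) :=
    hK.ofReal.1.mul hf.1.comp_snd
  exact h.integral_prod_right'

/-- For almost every `x`, the integrals defining `T_K` converge. -/
theorem ae_integrable_kernel {d : ℕ} {K : Euc d × Euc d → ℝ} (hK : MemLp K 2 volume) :
    ∀ᵐ x : Euc d, ∀ f : Euc d → ℂ, MemLp f 2 volume →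
      Integrable (fun y => (K (x, y) : ℂ) * f y) := by
  have hKm : AEStronglyMeasurable K (volume.prod volume : Measure (Euc d × Euc d)) := hK.1
  have hfin : ∀ᵐ x : Euc d, ∫⁻ y, ‖K (x, y)‖ₑ ^ (2 : ℝ) < ∞ := by
    refine ae_lt_top' (hKm.enorm.pow_const _).lintegral_prod_right' ?_
    have := lintegral_rpow_enorm_lt_top_of_eLpNorm_lt_top (by norm_num) (by norm_num) hK.2
    rw [Measure.volume_eq_prod, lintegral_prod _ (hKm.enorm.pow_const _)] at this
    simpa using this.ne
  filter_upwards [hKm.prodMk_left, hfin] with x hx hx2 f hf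
  have h : MemLp (fun y => K (x, y)) 2 volume := by
    refine ⟨hx, ?_⟩
    rw [eLpNorm_lt_top_iff_lintegral_rpow_enorm_lt_top (by norm_num) (by norm_num)]
    simpa using hx2
  exact h.ofReal.integrable_mul hf

/-- The integral operator `T_K` on `L²(ℝ^d)` with kernel `K ∈ L²(ℝ^d × ℝ^d)`:
`(T_K f)(x) = ∫ K(x, y) f(y) dy`. -/
def kernelOp {d : ℕ} (K : Euc d × Euc d → ℝ) (hK : MemLp K 2 volume) : L2 d →L[ℂ] L2 d :=
  LinearMap.mkContinuous
    { toFun := fun f => (memLp_integral_kernel hK (Lp.memLp f)).toLp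
        (fun x => ∫ y, (K (x, y) : ℂ) * f y)
      map_add' := by
        intro f g
        rw [← MemLp.toLp_add, MemLp.toLp_eq_toLp_iff]
        filter_upwards [ae_integrable_kernel hK] with x hx
        rw [Pi.add_apply, ← integral_add (hx f (Lp.memLp f)) (hx g (Lp.memLp g))]
        refine integral_congr_ae ?_
        filter_upwards [Lp.coeFn_add f g] with y hy
        rw [hy, Pi.add_apply, mul_add]
      map_smul' := by
        intro c f
        rw [RingHom.id_apply, ← MemLp.toLp_const_smul, MemLp.toLp_eq_toLp_iff]
        refine Filter.Eventually.of_forall fun x => ?_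
        rw [Pi.smul_apply, ← integral_smul]
        refine integral_congr_ae ?_
        filter_upwards [Lp.coeFn_smul c f] with y hy
        rw [hy, Pi.smul_apply, smul_eq_mul, smul_eq_mul, mul_left_comm] }
    (eLpNorm K 2 volume).toReal
    (by
      intro f
      simp only [LinearMap.coe_mk, AddHom.coe_mk]
      rw [Lp.norm_toLp, Lp.norm_def, ← ENNReal.toReal_mul]
      exact ENNReal.toReal_mono (ENNReal.mul_ne_top hK.2.ne (Lp.memLp f).2.ne)
        (eLpNorm_integral_kernel_le hK (Lp.memLp f)))

/-- The defining formula of `T_K`. -/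
theorem kernelOp_apply_ae {d : ℕ} (K : Euc d × Euc d → ℝ) (hK : MemLp K 2 volume) (f : L2 d) :
    kernelOp K hK f =ᵐ[volume] fun x => ∫ y, (K (x, y) : ℂ) * f y :=
  (memLp_integral_kernel hK (Lp.memLp f)).coeFn_toLp

/-- The absolute value `|T| = (T* T)^{1/2}` of a bounded operator on a complex Hilbert space
(for self-adjoint `T`, the unique positive operator with `|T|² = T²`). -/
def operatorAbs {H : Type*} [NormedAddCommGroup H] [InnerProductSpace ℂ H] [CompleteSpace H]
    (T : H →L[ℂ] H) : H →L[ℂ] H :=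
  CFC.abs T

/-- `K(x, y) = K(y, x)` for almost every `(x, y)`. -/
def IsSymmKernel {d : ℕ} (K : Euc d × Euc d → ℝ) : Prop :=
  ∀ᵐ z : Euc d × Euc d, K z = K z.swap

/-! ### Sobolev regularity of kernels -/

theorem memLp_kernel_toLp {d : ℕ} {K : Euc d × Euc d → ℝ} (hK : MemLp K 2 volume) :
    MemLp (fun z : EucProd d => (K (WithLp.ofLp z) : ℂ)) 2 volume :=
  (hK.comp_measurePreserving (WithLp.volume_preserving_ofLp (Euc d) (Euc d))).ofReal

/-- The kernel `K` as an element of `L²(ℝ^d × ℝ^d)`. -/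
def kernelLp {d : ℕ} (K : Euc d × Euc d → ℝ) (hK : MemLp K 2 volume) :
    Lp ℂ 2 (volume : Measure (EucProd d)) :=
  (memLp_kernel_toLp hK).toLp (fun z : EucProd d => (K (WithLp.ofLp z) : ℂ))

/-- `K ∈ H^s(ℝ^d × ℝ^d)`, where `K` is regarded as a tempered distribution. -/
def KernelMemSobolev {d : ℕ} (s : ℝ) (K : Euc d × Euc d → ℝ) (hK : MemLp K 2 volume) : Prop :=
  TemperedDistribution.MemSobolev s 2 (kernelLp K hK : 𝓢'(EucProd d, ℂ))

/-- The `H^s` norm `(∫ (1 + |ζ|²)^s |K̂(ζ)|² dζ)^{1/2}`, with value `∞` if the integral diverges.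
Here `K̂` is the (unitary) Fourier transform `∫ e^{-2πi ζ·z} K(z) dz` of `K ∈ L²`. -/
def kernelSobolevNorm {d : ℕ} (s : ℝ) (K : Euc d × Euc d → ℝ) (hK : MemLp K 2 volume) : ℝ≥0∞ :=
  (∫⁻ ζ : EucProd d, ENNReal.ofReal ((1 + ‖ζ‖ ^ 2) ^ s)
    * ‖(𝓕 (kernelLp K hK) : Lp ℂ 2 (volume : Measure (EucProd d))) ζ‖ₑ ^ 2) ^ (1 / 2 : ℝ)

end

noncomputable section

open scoped InnerProductSpace ComplexConjugate

/-! The only property of the absolute value behind the estimates is `‖|T| f‖ = ‖T f‖` for all `f`.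
The squared `L²` norm of a kernel is the Hilbert-Schmidt norm `∑ ‖P e_j‖²` over an orthonormal
basis, so it depends only on the function `f ↦ ‖P f‖`. This survives localisation in frequency:
Fourier transforming the kernel `B` of `P` and cutting it off to `η ∈ E` in the second variable
replaces `P` by `𝓕 P R`, where `R` depends only on `E` and the unitary `𝓕` on the left preserves
norms. Hence the marginal of `|B̂(ξ, η)|²` in `η` is the same for the kernels of `T` and `|T|`
(`HasKernel.lintegral_fourier_snd_eq`).

For a symmetric kernel the marginals in `ξ` and `η` agree, and `(1 + |ξ|² + |η|²)^s` is at most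
`2^s` times the sum of the weights in `ξ` and in `η`. The `η`-marginal therefore controls the whole
`H^s` norm (`lintegral_weight_le`), with a constant free of `d`. The argument is symmetric in `T`
and `|T|`, so it gives both inequalities.

It remains to see that `|T|` has a real symmetric kernel. One exists in `L²` because `|T|` has the
same finite Hilbert-Schmidt norm as `T` (`exists_hasKernel`). It is real because `|T|` commutes with
conjugation, by uniqueness of the positive square root, and symmetric because `|T|` is self-adjoint.
-/

/-- The Hilbert space `L²(ℝ^d × ℝ^d)`. -/
abbrev L2Prod (d : ℕ) : Type := Lp ℂ 2 (volume : Measure (EucProd d))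

/-! ### Integration over the product -/

theorem quasiMeasurePreserving_fst_ofLp (d : ℕ) :
    Measure.QuasiMeasurePreserving (fun z : EucProd d => z.ofLp.1) volume volume :=
  Measure.quasiMeasurePreserving_fst.comp
    (WithLp.volume_preserving_ofLp (Euc d) (Euc d)).quasiMeasurePreserving

theorem quasiMeasurePreserving_snd_ofLp (d : ℕ) :
    Measure.QuasiMeasurePreserving (fun z : EucProd d => z.ofLp.2) volume volume :=
  Measure.quasiMeasurePreserving_snd.comp
    (WithLp.volume_preserving_ofLp (Euc d) (Euc d)).quasiMeasurePreserving

theorem integral_eucProd {d : ℕ} (f : EucProd d → ℂ) :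
    ∫ z, f z = ∫ p : Euc d × Euc d, f (WithLp.toLp 2 p) :=
  ((WithLp.volume_preserving_toLp (Euc d) (Euc d)).integral_comp
    (MeasurableEquiv.toLp 2 (Euc d × Euc d)).measurableEmbedding f).symm

theorem integral_eucProd_mul {d : ℕ} (f g : Euc d → ℂ) :
    ∫ z : EucProd d, f z.ofLp.1 * g z.ofLp.2 = (∫ x, f x) * ∫ y, g y := by
  rw [integral_eucProd, Measure.volume_eq_prod]
  exact integral_prod_mul f g

theorem integrable_eucProd_iff {d : ℕ} {f : EucProd d → ℂ} :
    Integrable f ↔ Integrable (fun p : Euc d × Euc d => f (WithLp.toLp 2 p)) :=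
  ((WithLp.volume_preserving_toLp (Euc d) (Euc d)).integrable_comp_emb
    (MeasurableEquiv.toLp 2 (Euc d × Euc d)).measurableEmbedding).symm

theorem MeasureTheory.Integrable.eucProd_mul {d : ℕ} {f g : Euc d → ℂ} (hf : Integrable f)
    (hg : Integrable g) : Integrable (fun z : EucProd d => f z.ofLp.1 * g z.ofLp.2) :=
  integrable_eucProd_iff.2 (hf.mul_prod hg)

/-! ### Tensor products of square-integrable functions -/

theorem MeasureTheory.MemLp.eucProd_mul {d : ℕ} {f g : Euc d → ℂ} (hf : MemLp f 2 volume)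
    (hg : MemLp g 2 volume) :
    MemLp (fun z : EucProd d => f z.ofLp.1 * g z.ofLp.2) 2 volume := by
  have h1 := hf.1.comp_quasiMeasurePreserving (quasiMeasurePreserving_fst_ofLp d)
  have h2 := hg.1.comp_quasiMeasurePreserving (quasiMeasurePreserving_snd_ofLp d)
  refine (memLp_two_iff_integrable_sq_norm (h1.mul h2)).2 ?_
  have hf2 := ((memLp_two_iff_integrable_sq_norm hf.1).1 hf).ofReal (𝕜 := ℂ)
  have hg2 := ((memLp_two_iff_integrable_sq_norm hg.1).1 hg).ofReal (𝕜 := ℂ)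
  have h := (hf2.eucProd_mul hg2).re
  refine h.congr (Filter.Eventually.of_forall fun z => ?_)
  simp only [Pi.mul_apply, Function.comp_apply, norm_mul, mul_pow]
  rw [← RCLike.ofReal_mul, RCLike.ofReal_re]

/-- The tensor product `(f ⊗ g)(x, y) = f(x) g(y)`. -/
def tensorLp {d : ℕ} (f g : L2 d) : L2Prod d :=
  ((Lp.memLp f).eucProd_mul (Lp.memLp g)).toLp _

theorem coeFn_tensorLp {d : ℕ} (f g : L2 d) :
    tensorLp f g =ᵐ[volume] fun z : EucProd d => f z.ofLp.1 * g z.ofLp.2 :=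
  MemLp.coeFn_toLp _

theorem tensorLp_toLp {d : ℕ} {f g : Euc d → ℂ} (hf : MemLp f 2 volume) (hg : MemLp g 2 volume) :
    tensorLp (hf.toLp f) (hg.toLp g) = (hf.eucProd_mul hg).toLp _ := by
  refine (MemLp.toLp_eq_toLp_iff _ _).2 ?_
  filter_upwards [(quasiMeasurePreserving_fst_ofLp d).ae hf.coeFn_toLp,
    (quasiMeasurePreserving_snd_ofLp d).ae hg.coeFn_toLp] with z h1 h2
  rw [h1, h2]

theorem tensorLp_add_left {d : ℕ} (f₁ f₂ g : L2 d) :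
    tensorLp (f₁ + f₂) g = tensorLp f₁ g + tensorLp f₂ g := by
  refine Lp.ext ?_
  filter_upwards [coeFn_tensorLp (f₁ + f₂) g, coeFn_tensorLp f₁ g, coeFn_tensorLp f₂ g,
    Lp.coeFn_add (tensorLp f₁ g) (tensorLp f₂ g),
    (quasiMeasurePreserving_fst_ofLp d).ae (Lp.coeFn_add f₁ f₂)] with z h1 h2 h3 h4 h5
  rw [h1, h4, Pi.add_apply, h2, h3, h5, Pi.add_apply, add_mul]

theorem tensorLp_add_right {d : ℕ} (f g₁ g₂ : L2 d) :
    tensorLp f (g₁ + g₂) = tensorLp f g₁ + tensorLp f g₂ := by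
  refine Lp.ext ?_
  filter_upwards [coeFn_tensorLp f (g₁ + g₂), coeFn_tensorLp f g₁, coeFn_tensorLp f g₂,
    Lp.coeFn_add (tensorLp f g₁) (tensorLp f g₂),
    (quasiMeasurePreserving_snd_ofLp d).ae (Lp.coeFn_add g₁ g₂)] with z h1 h2 h3 h4 h5
  rw [h1, h4, Pi.add_apply, h2, h3, h5, Pi.add_apply, mul_add]

theorem tensorLp_smul_left {d : ℕ} (c : ℂ) (f g : L2 d) :
    tensorLp (c • f) g = c • tensorLp f g := by
  refine Lp.ext ?_
  filter_upwards [coeFn_tensorLp (c • f) g, coeFn_tensorLp f g,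
    Lp.coeFn_smul c (tensorLp f g),
    (quasiMeasurePreserving_fst_ofLp d).ae (Lp.coeFn_smul c f)] with z h1 h2 h3 h4
  rw [h1, h3, Pi.smul_apply, h2, h4, Pi.smul_apply, smul_eq_mul, smul_eq_mul, mul_assoc]

theorem tensorLp_smul_right {d : ℕ} (c : ℂ) (f g : L2 d) :
    tensorLp f (c • g) = c • tensorLp f g := by
  refine Lp.ext ?_
  filter_upwards [coeFn_tensorLp f (c • g), coeFn_tensorLp f g,
    Lp.coeFn_smul c (tensorLp f g),
    (quasiMeasurePreserving_snd_ofLp d).ae (Lp.coeFn_smul c g)] with z h1 h2 h3 h4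
  rw [h1, h3, Pi.smul_apply, h2, h4, Pi.smul_apply, smul_eq_mul, smul_eq_mul, mul_left_comm]

theorem inner_tensorLp_tensorLp {d : ℕ} (f g f' g' : L2 d) :
    ⟪tensorLp f g, tensorLp f' g'⟫_ℂ = ⟪f, f'⟫_ℂ * ⟪g, g'⟫_ℂ := by
  rw [L2.inner_def, L2.inner_def, L2.inner_def,
    ← integral_eucProd_mul (fun x => ⟪f x, f' x⟫_ℂ) (fun y => ⟪g y, g' y⟫_ℂ)]
  refine integral_congr_ae ?_
  filter_upwards [coeFn_tensorLp f g, coeFn_tensorLp f' g'] with z h1 h2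
  rw [h1, h2]
  simp only [RCLike.inner_apply, map_mul]
  ring

theorem norm_tensorLp {d : ℕ} (f g : L2 d) : ‖tensorLp f g‖ = ‖f‖ * ‖g‖ := by
  have h := inner_tensorLp_tensorLp f g f g
  simp only [inner_self_eq_norm_sq_to_K] at h
  norm_cast at h
  rw [← mul_pow] at h
  exact (pow_left_inj₀ (norm_nonneg _) (by positivity) two_ne_zero).1 h

/-- The tensor product as a continuous bilinear map. -/
def tensorCLM (d : ℕ) : L2 d →L[ℂ] L2 d →L[ℂ] L2Prod d :=
  LinearMap.mkContinuous₂
    (LinearMap.mk₂ ℂ tensorLp tensorLp_add_left tensorLp_smul_left tensorLp_add_right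
      tensorLp_smul_right) 1
    (fun f g => by rw [LinearMap.mk₂_apply, norm_tensorLp, one_mul])

theorem tensorCLM_apply {d : ℕ} (f g : L2 d) : tensorCLM d f g = tensorLp f g := rfl

/-! ### Functions with vanishing integrals over rectangles -/

/-- A π-λ argument: rectangles form a π-system generating the product σ-algebra, and on a rectangle
of finite measure the sets with zero integral are closed under complements and disjoint unions. -/
theorem ae_eq_zero_of_forall_setIntegral_prod_eq_zero {α β : Type*} [MeasurableSpace α]
    [MeasurableSpace β] {μ : Measure α} {ν : Measure β} [SigmaFinite μ] [SigmaFinite ν]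
    {B : α × β → ℂ}
    (hi : ∀ s t, MeasurableSet s → μ s < ∞ → MeasurableSet t → ν t < ∞ →
      IntegrableOn B (s ×ˢ t) (μ.prod ν))
    (h0 : ∀ s t, MeasurableSet s → μ s < ∞ → MeasurableSet t → ν t < ∞ →
      ∫ z in s ×ˢ t, B z ∂μ.prod ν = 0) :
    B =ᵐ[μ.prod ν] 0 := by
  have key : ∀ n : ℕ, B =ᵐ[(μ.prod ν).restrict (spanningSets μ n ×ˢ spanningSets ν n)] 0 := by
    intro n
    have hS := measurableSet_spanningSets μ n
    have hT := measurableSet_spanningSets ν n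
    have hS' := measure_spanningSets_lt_top μ n
    have hT' := measure_spanningSets_lt_top ν n
    have hint := hi _ _ hS hS' hT hT'
    refine Integrable.ae_eq_zero_of_forall_setIntegral_eq_zero hint fun s hs hfin => ?_
    -- Integrability on the spanning rectangle suffices; the induction should not carry a finiteness
    -- assumption.
    clear hfin
    induction s, hs using MeasurableSpace.induction_on_inter generateFrom_prod.symm
      isPiSystem_prod with
    | empty => simp
    | basic t ht =>
      obtain ⟨a, ha, b, hb, rfl⟩ := ht
      rw [Measure.restrict_restrict (MeasurableSet.prod ha hb), Set.prod_inter_prod]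
      exact h0 _ _ (MeasurableSet.inter ha hS)
        ((measure_mono Set.inter_subset_right).trans_lt hS') (MeasurableSet.inter hb hT)
        ((measure_mono Set.inter_subset_right).trans_lt hT')
    | compl t ht ih =>
      have := integral_add_compl ht hint
      rw [ih, zero_add, h0 _ _ hS hS' hT hT'] at this
      exact this
    | iUnion f hd hm ih =>
      rw [integral_iUnion hm hd hint.integrableOn]
      simp [ih]
  have hU : ⋃ n : ℕ, spanningSets μ n ×ˢ spanningSets ν n = Set.univ := by
    rw [Set.iUnion_prod_of_monotone (monotone_spanningSets μ) (monotone_spanningSets ν),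
      iUnion_spanningSets, iUnion_spanningSets, Set.univ_prod_univ]
  have := (ae_restrict_iUnion_iff (fun n : ℕ => spanningSets μ n ×ˢ spanningSets ν n)
    (μ := μ.prod ν) (fun z => B z = 0)).2 key
  rwa [hU, Measure.restrict_univ] at this

/-- Tensors of indicator functions already detect all integrals over rectangles. This totality lets
identities between kernels be tested on pure tensors. -/
theorem eq_zero_of_forall_inner_tensorLp {d : ℕ} {B : L2Prod d}
    (h : ∀ f g : L2 d, ⟪tensorLp f g, B⟫_ℂ = 0) : B = 0 := by
  have hrect : ∀ s t : Set (Euc d), MeasurableSet s → volume s < ∞ → MeasurableSet t →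
      volume t < ∞ → IntegrableOn (fun p => B (WithLp.toLp 2 p)) (s ×ˢ t)
        (volume.prod volume) ∧ ∫ p in s ×ˢ t, B (WithLp.toLp 2 p) ∂volume.prod volume = 0 := by
    intro s t hs hs' ht ht'
    have e : ∀ᵐ z : EucProd d,
        ⟪tensorLp (indicatorConstLp 2 hs hs'.ne (1 : ℂ)) (indicatorConstLp 2 ht ht'.ne 1) z, B z⟫_ℂ
          = (s ×ˢ t).indicator (fun p => B (WithLp.toLp 2 p)) z.ofLp := by
      filter_upwards [coeFn_tensorLp (indicatorConstLp 2 hs hs'.ne (1 : ℂ))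
          (indicatorConstLp 2 ht ht'.ne 1),
        (quasiMeasurePreserving_fst_ofLp d).ae (indicatorConstLp_coeFn (p := 2) (hs := hs)
          (hμs := hs'.ne) (c := (1 : ℂ))),
        (quasiMeasurePreserving_snd_ofLp d).ae (indicatorConstLp_coeFn (p := 2) (hs := ht)
          (hμs := ht'.ne) (c := (1 : ℂ)))] with z h1 h2 h3
      rw [h1, h2, h3]
      classical
      have hm : z.ofLp ∈ s ×ˢ t ↔ z.ofLp.1 ∈ s ∧ z.ofLp.2 ∈ t := Iff.rfl
      rw [Set.indicator_apply, Set.indicator_apply, Set.indicator_apply, RCLike.inner_apply]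
      simp only [hm]
      split_ifs with h4 h5 h6 <;> simp_all
    have hi := (integrable_congr e).1 (L2.integrable_inner _ B)
    have h0 := h (indicatorConstLp 2 hs hs'.ne (1 : ℂ)) (indicatorConstLp 2 ht ht'.ne 1)
    rw [L2.inner_def, integral_congr_ae e, integral_eucProd] at h0
    rw [integrable_eucProd_iff] at hi
    exact ⟨(integrable_indicator_iff (hs.prod ht)).1 hi,
      (integral_indicator (hs.prod ht)).symm.trans h0⟩
  have := ae_eq_zero_of_forall_setIntegral_prod_eq_zero
    (fun s t hs hs' ht ht' => (hrect s t hs hs' ht ht').1)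
    (fun s t hs hs' ht ht' => (hrect s t hs hs' ht ht').2)
  refine Lp.ext ?_
  filter_upwards [(WithLp.volume_preserving_ofLp (Euc d) (Euc d)).quasiMeasurePreserving.ae this,
    Lp.coeFn_zero ℂ 2 (volume : Measure (EucProd d))] with z hz hz'
  rw [hz']
  exact hz

theorem ext_inner_tensorLp {d : ℕ} {B B' : L2Prod d}
    (h : ∀ f g : L2 d, ⟪tensorLp f g, B⟫_ℂ = ⟪tensorLp f g, B'⟫_ℂ) : B = B' :=
  sub_eq_zero.1 (eq_zero_of_forall_inner_tensorLp fun f g => by rw [inner_sub_right, h, sub_self])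

/-! ### Hilbert bases of tensor products -/

theorem HilbertBasis.ext_inner {ι E : Type*} [NormedAddCommGroup E] [InnerProductSpace ℂ E]
    (b : HilbertBasis ι ℂ E) {x y : E} (h : ∀ i, ⟪b i, x⟫_ℂ = ⟪b i, y⟫_ℂ) : x = y := by
  refine b.repr.injective (lp.ext (funext fun i => ?_))
  rw [b.repr_apply_apply, b.repr_apply_apply, h]

theorem HilbertBasis.tsum_enorm_inner_sq {ι E : Type*} [NormedAddCommGroup E]
    [InnerProductSpace ℂ E] (b : HilbertBasis ι ℂ E) (x : E) :
    ∑' i, ‖⟪b i, x⟫_ℂ‖ₑ ^ 2 = ‖x‖ₑ ^ 2 := by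
  have h : HasSum (fun i => ‖⟪b i, x⟫_ℂ‖ ^ 2) (‖x‖ ^ 2) := by
    have h1 := (b.hasSum_inner_mul_inner x x).mapL RCLike.reCLM
    simp only [RCLike.reCLM_apply, inner_mul_symm_re_eq_norm, inner_self_eq_norm_sq] at h1
    refine h1.congr_fun fun i => ?_
    rw [norm_mul, ← inner_conj_symm x, RCLike.norm_conj, sq]
  simp only [← ofReal_norm, ← ENNReal.ofReal_pow (norm_nonneg _)]
  rw [← ENNReal.ofReal_tsum_of_nonneg (fun _ => by positivity) h.summable, h.tsum_eq]

theorem orthonormal_tensorLp {d : ℕ} {ι : Type*} (b : HilbertBasis ι ℂ (L2 d)) :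
    Orthonormal ℂ (fun p : ι × ι => tensorLp (b p.1) (b p.2)) := by
  classical
  rw [orthonormal_iff_ite]
  intro p q
  rw [inner_tensorLp_tensorLp, orthonormal_iff_ite.1 b.orthonormal,
    orthonormal_iff_ite.1 b.orthonormal]
  by_cases h1 : p.1 = q.1 <;> by_cases h2 : p.2 = q.2 <;> simp [h1, h2, Prod.ext_iff]

/-- Parseval for the basis `b i ⊗ b j`, complete because one tensor factor at a time can be freed
from the basis. The sum over the first factor is innermost, so that it can later be recognised as
the squared norm of one image vector. -/
theorem tsum_enorm_inner_tensorLp_sq {d : ℕ} {ι : Type*} (b : HilbertBasis ι ℂ (L2 d))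
    (B : L2Prod d) :
    ∑' j, ∑' i, ‖⟪tensorLp (b i) (b j), B⟫_ℂ‖ₑ ^ 2 = ‖B‖ₑ ^ 2 := by
  have hb : (Submodule.span ℂ (Set.range fun p : ι × ι => tensorLp (b p.1) (b p.2)))ᗮ = ⊥ := by
    refine (Submodule.eq_bot_iff _).2 fun B hB => eq_zero_of_forall_inner_tensorLp fun f g => ?_
    have h0 : ∀ i j, ⟪tensorLp (b i) (b j), B⟫_ℂ = 0 := fun i j =>
      Submodule.inner_right_of_mem_orthogonal (Submodule.subset_span (Set.mem_range_self (i, j))) hB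
    have h1 : ∀ i g, ⟪tensorLp (b i) g, B⟫_ℂ = 0 := fun i g => by
      have : ContinuousLinearMap.adjoint (tensorCLM d (b i)) B = 0 :=
        b.ext_inner fun j => by
          rw [ContinuousLinearMap.adjoint_inner_right, tensorCLM_apply, h0, inner_zero_right]
      rw [← tensorCLM_apply, ← ContinuousLinearMap.adjoint_inner_right, this, inner_zero_right]
    have : ContinuousLinearMap.adjoint ((tensorCLM d).flip g) B = 0 :=
      b.ext_inner fun i => by
        rw [ContinuousLinearMap.adjoint_inner_right, ContinuousLinearMap.flip_apply,
          tensorCLM_apply, h1, inner_zero_right]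
    rw [← tensorCLM_apply, ← ContinuousLinearMap.flip_apply,
      ← ContinuousLinearMap.adjoint_inner_right, this, inner_zero_right]
  have h := (HilbertBasis.mkOfOrthogonalEqBot (orthonormal_tensorLp b) hb).tsum_enorm_inner_sq B
  rw [HilbertBasis.coe_mkOfOrthogonalEqBot,
    ENNReal.tsum_prod (f := fun i j => ‖⟪tensorLp (b i) (b j), B⟫_ℂ‖ₑ ^ 2),
    ENNReal.tsum_comm] at h
  exact h

/-! ### The Fourier transform of tensor products -/

/-- The `L²` transform, defined by extension, agrees with the Fourier integral: pair both with a
Schwartz function and move the transform across by Fubini. -/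
theorem Lp_fourier_toLp_eq {V : Type*} [NormedAddCommGroup V] [InnerProductSpace ℝ V]
    [FiniteDimensional ℝ V] [MeasurableSpace V] [BorelSpace V] {h : V → ℂ} (h1 : Integrable h)
    (h2 : MemLp h 2 volume) (h3 : MemLp (𝓕 h) 2 volume) :
    𝓕 (h2.toLp h) = h3.toLp (𝓕 h) := by
  refine (SchwartzMap.denseRange_toLpCLM (F := ℂ) (p := 2) (μ := (volume : Measure V))
    ENNReal.ofNat_ne_top).eq_of_inner_left ℂ ?_
  intro u
  rw [SchwartzMap.toLpCLM_apply]
  have e1 : ⟪𝓕 (h2.toLp h), u.toLp 2 volume⟫_ℂ = ⟪h2.toLp h, (𝓕⁻ u).toLp 2 volume⟫_ℂ := by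
    rw [← SchwartzMap.toLp_fourierInv_eq, ← Lp.inner_fourier_eq (h2.toLp h),
      FourierTransform.fourier_fourierInv_eq]
  rw [e1, L2.inner_def, L2.inner_def]
  have e2 : ∫ x, ⟪h2.toLp h x, (𝓕⁻ u).toLp 2 volume x⟫_ℂ = ∫ x, ⟪h x, (𝓕⁻ u) x⟫_ℂ := by
    refine integral_congr_ae ?_
    filter_upwards [h2.coeFn_toLp, (𝓕⁻ u).coeFn_toLp 2 volume] with x hx hx'
    rw [hx, hx']
  have e3 : ∫ x, ⟪h3.toLp (𝓕 h) x, u.toLp 2 volume x⟫_ℂ = ∫ x, ⟪𝓕 h x, u x⟫_ℂ := by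
    refine integral_congr_ae ?_
    filter_upwards [h3.coeFn_toLp, u.coeFn_toLp 2 volume] with x hx hx'
    rw [hx, hx']
  rw [e2, e3]
  symm
  simpa [SchwartzMap.fourierInv_coe] using! VectorFourier.integral_sesq_fourierIntegral_eq_neg_flip
    (innerSL ℂ) (μ := volume) (ν := volume) (L := innerₗ V) (f := h) (g := u)
    Real.continuous_fourierChar continuous_inner h1 u.integrable

theorem fourier_eucProd_mul {d : ℕ} (f g : Euc d → ℂ) (ζ : EucProd d) :
    𝓕 (fun z : EucProd d => f z.ofLp.1 * g z.ofLp.2) ζ = 𝓕 f ζ.ofLp.1 * 𝓕 g ζ.ofLp.2 := by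
  rw [Real.fourier_eq, Real.fourier_eq, Real.fourier_eq, ← integral_eucProd_mul]
  refine integral_congr_ae (Filter.Eventually.of_forall fun z => ?_)
  simp only [WithLp.prod_inner_apply, neg_add, AddChar.map_add_eq_mul, Circle.smul_def,
    Circle.coe_mul, smul_eq_mul]
  ring

/-- Both sides are continuous in `(f, g)`, and for Schwartz functions the Fourier integral
factorises. -/
theorem fourier_tensorLp {d : ℕ} (f g : L2 d) : 𝓕 (tensorLp f g) = tensorLp (𝓕 f) (𝓕 g) := by
  have hcF : Continuous fun f : L2 d => 𝓕 f := (Lp.fourierTransformₗᵢ (Euc d) ℂ).continuous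
  have hcF' : Continuous fun B : L2Prod d => 𝓕 B :=
    (Lp.fourierTransformₗᵢ (EucProd d) ℂ).continuous
  have hc : Continuous fun p : L2 d × L2 d => tensorLp p.1 p.2 :=
    (tensorCLM d).continuous₂
  have hD := SchwartzMap.denseRange_toLpCLM (E := Euc d) (F := ℂ) (p := 2) (μ := volume)
    ENNReal.ofNat_ne_top
  refine (hD.prodMap hD).induction_on (p := fun p => 𝓕 (tensorLp p.1 p.2) =
    tensorLp (𝓕 p.1) (𝓕 p.2)) (f, g) ?_ ?_
  · exact isClosed_eq (hcF'.comp hc)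
      (hc.comp ((hcF.comp continuous_fst).prodMk (hcF.comp continuous_snd)))
  · rintro ⟨u, v⟩
    simp only [Prod.map, SchwartzMap.toLpCLM_apply, SchwartzMap.toLp_fourier_eq]
    have hF : 𝓕 (fun z : EucProd d => u z.ofLp.1 * v z.ofLp.2)
        = fun ζ => 𝓕 u ζ.ofLp.1 * 𝓕 v ζ.ofLp.2 := by
      funext ζ
      rw [fourier_eucProd_mul, SchwartzMap.fourier_coe, SchwartzMap.fourier_coe]
    have h3 : MemLp (𝓕 (fun z : EucProd d => u z.ofLp.1 * v z.ofLp.2)) 2 volume := by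
      rw [hF]
      exact ((𝓕 u).memLp 2 volume).eucProd_mul ((𝓕 v).memLp 2 volume)
    refine (congrArg _ (tensorLp_toLp (u.memLp 2 volume) (v.memLp 2 volume))).trans ?_
    refine (Lp_fourier_toLp_eq (u.integrable.eucProd_mul v.integrable) _ h3).trans ?_
    refine Eq.trans ?_ (tensorLp_toLp ((𝓕 u).memLp 2 volume) ((𝓕 v).memLp 2 volume)).symm
    congr 1

theorem inner_fourier_right {V : Type*} [NormedAddCommGroup V] [InnerProductSpace ℝ V]
    [FiniteDimensional ℝ V] [MeasurableSpace V] [BorelSpace V]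
    (f g : Lp ℂ 2 (volume : Measure V)) : ⟪f, 𝓕 g⟫_ℂ = ⟪𝓕⁻ f, g⟫_ℂ := by
  rw [← Lp.inner_fourier_eq (𝓕⁻ f), FourierTransform.fourier_fourierInv_eq]

theorem fourierInv_tensorLp {d : ℕ} (f g : L2 d) :
    𝓕⁻ (tensorLp f g) = tensorLp (𝓕⁻ f) (𝓕⁻ g) := by
  have h := fourier_tensorLp (𝓕⁻ f) (𝓕⁻ g)
  rw [FourierTransform.fourier_fourierInv_eq, FourierTransform.fourier_fourierInv_eq] at h
  rw [← h, FourierTransform.fourierInv_fourier_eq]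

/-! ### Conjugation, cut-off and swap on `L²` -/

section Operations

variable {α : Type*} [MeasurableSpace α] {μ : Measure α}

theorem inner_star_left (f g : Lp ℂ 2 μ) : ⟪star f, g⟫_ℂ = conj ⟪f, star g⟫_ℂ := by
  rw [L2.inner_def, L2.inner_def, ← integral_conj]
  refine integral_congr_ae ?_
  filter_upwards [Lp.coeFn_star f, Lp.coeFn_star g] with x h1 h2
  rw [h1, h2]
  simp [RCLike.inner_apply]

theorem inner_star_right (f g : Lp ℂ 2 μ) : ⟪f, star g⟫_ℂ = conj ⟪star f, g⟫_ℂ := by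
  rw [inner_star_left, Complex.conj_conj]

theorem star_add_Lp (f g : Lp ℂ 2 μ) : star (f + g) = star f + star g := by
  refine Lp.ext ?_
  filter_upwards [Lp.coeFn_star f, Lp.coeFn_star g, Lp.coeFn_add f g, Lp.coeFn_star (f + g),
    Lp.coeFn_add (star f) (star g)] with x h1 h2 h3 h4 h5
  rw [h4, h5, Pi.star_apply, h3, Pi.add_apply, Pi.add_apply, h1, h2, Pi.star_apply, Pi.star_apply,
    star_add]

theorem star_smul_Lp (c : ℂ) (f : Lp ℂ 2 μ) : star (c • f) = conj c • star f := by
  refine Lp.ext ?_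
  filter_upwards [Lp.coeFn_star f, Lp.coeFn_smul c f, Lp.coeFn_star (c • f),
    Lp.coeFn_smul (conj c) (star f)] with x h1 h2 h3 h4
  rw [h3, h4, Pi.star_apply, h2, Pi.smul_apply, Pi.smul_apply, h1, Pi.star_apply, star_smul]
  rfl

theorem norm_star_Lp (f : Lp ℂ 2 μ) : ‖star f‖ = ‖f‖ := by
  simp only [Lp.norm_def]
  refine congrArg _ (eLpNorm_congr_norm_ae ?_)
  filter_upwards [Lp.coeFn_star f] with x hx
  rw [hx, Pi.star_apply, norm_star]

/-- The cut-off `f ↦ 1_E f`. -/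
def indicatorLp {E : Set α} (hE : MeasurableSet E) (f : Lp ℂ 2 μ) : Lp ℂ 2 μ :=
  ((Lp.memLp f).indicator hE).toLp (E.indicator f)

theorem coeFn_indicatorLp {E : Set α} (hE : MeasurableSet E) (f : Lp ℂ 2 μ) :
    indicatorLp hE f =ᵐ[μ] E.indicator f :=
  MemLp.coeFn_toLp _

theorem enorm_sq_Lp (f : Lp ℂ 2 μ) : ‖f‖ₑ ^ 2 = ∫⁻ x, ‖f x‖ₑ ^ 2 ∂μ := by
  rw [Lp.enorm_def, eLpNorm_eq_lintegral_rpow_enorm_toReal (by norm_num) (by norm_num),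
    ← ENNReal.rpow_natCast, ← ENNReal.rpow_mul]
  norm_num

theorem enorm_indicatorLp_sq {E : Set α} (hE : MeasurableSet E) (f : Lp ℂ 2 μ) :
    ‖indicatorLp hE f‖ₑ ^ 2 = ∫⁻ x in E, ‖f x‖ₑ ^ 2 ∂μ := by
  rw [enorm_sq_Lp, ← lintegral_indicator hE]
  refine lintegral_congr_ae ?_
  filter_upwards [coeFn_indicatorLp hE f] with x hx
  rw [hx]
  by_cases h : x ∈ E <;> simp [h]

end Operations

theorem star_tensorLp {d : ℕ} (f g : L2 d) : star (tensorLp f g) = tensorLp (star f) (star g) := by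
  refine Lp.ext ?_
  filter_upwards [Lp.coeFn_star (tensorLp f g), coeFn_tensorLp f g,
    coeFn_tensorLp (star f) (star g), (quasiMeasurePreserving_fst_ofLp d).ae (Lp.coeFn_star f),
    (quasiMeasurePreserving_snd_ofLp d).ae (Lp.coeFn_star g)] with z h1 h2 h3 h4 h5
  rw [h1, h3, Pi.star_apply, h2, h4, h5, Pi.star_apply, Pi.star_apply, star_mul']

theorem measurableSet_snd_ofLp {d : ℕ} {E : Set (Euc d)} (hE : MeasurableSet E) :
    MeasurableSet ((fun z : EucProd d => z.ofLp.2) ⁻¹' E) :=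
  (quasiMeasurePreserving_snd_ofLp d).measurable hE

theorem inner_tensorLp_indicatorLp {d : ℕ} {E : Set (Euc d)} (hE : MeasurableSet E) (f g : L2 d)
    (B : L2Prod d) : ⟪tensorLp f g, indicatorLp (measurableSet_snd_ofLp hE) B⟫_ℂ
      = ⟪tensorLp f (indicatorLp hE g), B⟫_ℂ := by
  rw [L2.inner_def, L2.inner_def]
  refine integral_congr_ae ?_
  filter_upwards [coeFn_tensorLp f g, coeFn_tensorLp f (indicatorLp hE g),
    coeFn_indicatorLp (measurableSet_snd_ofLp hE) B,
    (quasiMeasurePreserving_snd_ofLp d).ae (coeFn_indicatorLp hE g)] with z h1 h2 h3 h4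
  rw [h1, h2, h3, h4]
  classical
  rw [Set.indicator_apply, Set.indicator_apply]
  simp only [Set.mem_preimage]
  split_ifs <;> simp

theorem measurePreserving_swap_eucProd (d : ℕ) :
    MeasurePreserving (fun z : EucProd d => WithLp.toLp 2 z.ofLp.swap) volume volume :=
  (WithLp.volume_preserving_toLp (Euc d) (Euc d)).comp
    (Measure.measurePreserving_swap.comp (WithLp.volume_preserving_ofLp (Euc d) (Euc d)))

/-- The exchange of variables `B(x, y) ↦ B(y, x)`. -/
def swapLp {d : ℕ} (B : L2Prod d) : L2Prod d :=
  Lp.compMeasurePreserving _ (measurePreserving_swap_eucProd d) B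

theorem coeFn_swapLp {d : ℕ} (B : L2Prod d) :
    swapLp B =ᵐ[volume] fun z : EucProd d => B (WithLp.toLp 2 z.ofLp.swap) :=
  Lp.coeFn_compMeasurePreserving _ _

theorem integral_swap_eucProd {d : ℕ} (f : EucProd d → ℂ) :
    ∫ z : EucProd d, f (WithLp.toLp 2 z.ofLp.swap) = ∫ z, f z := by
  rw [integral_eucProd, integral_eucProd, Measure.volume_eq_prod]
  exact integral_prod_swap (fun p : Euc d × Euc d => f (WithLp.toLp 2 p))

theorem inner_tensorLp_swapLp {d : ℕ} (f g : L2 d) (B : L2Prod d) :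
    ⟪tensorLp f g, swapLp B⟫_ℂ = ⟪tensorLp g f, B⟫_ℂ := by
  rw [L2.inner_def, L2.inner_def, ← integral_swap_eucProd fun z => ⟪tensorLp g f z, B z⟫_ℂ]
  refine integral_congr_ae ?_
  filter_upwards [coeFn_tensorLp f g, coeFn_swapLp B,
    (measurePreserving_swap_eucProd d).quasiMeasurePreserving.ae (coeFn_tensorLp g f)]
    with z h1 h2 h3
  rw [h1, h2, h3]
  simp [mul_comm]

theorem fourier_swapLp {d : ℕ} (B : L2Prod d) : 𝓕 (swapLp B) = swapLp (𝓕 B) :=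
  ext_inner_tensorLp fun f g => by
    rw [inner_fourier_right, fourierInv_tensorLp, inner_tensorLp_swapLp, inner_tensorLp_swapLp,
      inner_fourier_right, fourierInv_tensorLp]

/-! ### Kernels of maps on `L²` -/

/-- The map `P` on `L²(ℝ^d)` has the kernel `B`: `⟨f ⊗ g, B⟩ = ⟨f, P ḡ⟩`. -/
def HasKernel {d : ℕ} (B : L2Prod d) (P : L2 d → L2 d) : Prop :=
  ∀ f g, ⟪tensorLp f g, B⟫_ℂ = ⟪f, P (star g)⟫_ℂ

namespace HasKernel

variable {d : ℕ} {B B' : L2Prod d} {P P' : L2 d → L2 d}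

theorem kernel_unique (h : HasKernel B P) (h' : HasKernel B' P) : B = B' :=
  ext_inner_tensorLp fun f g => (h f g).trans (h' f g).symm

theorem map_unique (h : HasKernel B P) (h' : HasKernel B P') : P = P' := by
  funext g
  refine ext_inner_left ℂ fun f => ?_
  have := (h f (star g)).symm.trans (h' f (star g))
  rwa [star_star] at this

protected theorem star (h : HasKernel B P) : HasKernel (star B) (fun g => star (P (star g))) := by
  intro f g
  rw [inner_star_right, star_tensorLp, h, inner_star_right f, star_star]

/-- Exchanging the variables gives the transpose, which is the conjugate of the adjoint. -/
theorem swapLp {T : L2 d →L[ℂ] L2 d} (h : HasKernel B T) :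
    HasKernel (swapLp B) (fun g => star (ContinuousLinearMap.adjoint T (star g))) := by
  intro f g
  rw [inner_tensorLp_swapLp, h, ← ContinuousLinearMap.adjoint_inner_left,
    inner_star_right (ContinuousLinearMap.adjoint T g), inner_conj_symm]
  simp only [star_star]

/-- The new map is `P` preceded by an operation independent of `P` and followed by a unitary, so its
norms are determined by those of `P`. -/
theorem fourier (h : HasKernel B P) :
    HasKernel (𝓕 B) (fun g => 𝓕 (P (star (𝓕⁻ (star g))))) := by
  intro f g
  rw [inner_fourier_right, fourierInv_tensorLp, h, inner_fourier_right, star_star]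

theorem indicatorLp (h : HasKernel B P) {E : Set (Euc d)} (hE : MeasurableSet E) :
    HasKernel (indicatorLp (measurableSet_snd_ofLp hE) B)
      (fun g => P (star (indicatorLp hE (star g)))) := by
  intro f g
  rw [inner_tensorLp_indicatorLp hE, h]
  simp only [star_star]

/-- The Hilbert-Schmidt norm of an operator is the `L²` norm of its kernel. -/
theorem tsum_enorm_sq (h : HasKernel B P) {ι : Type*} (b : HilbertBasis ι ℂ (L2 d)) :
    ∑' j, ‖P (star (b j))‖ₑ ^ 2 = ‖B‖ₑ ^ 2 := by
  rw [← tsum_enorm_inner_tensorLp_sq b B]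
  refine tsum_congr fun j => ?_
  simp only [h (b _) (b j)]
  exact (b.tsum_enorm_inner_sq _).symm

theorem enorm_sq_eq (h : HasKernel B P) (h' : HasKernel B' P') (hP : ∀ f, ‖P f‖ = ‖P' f‖) :
    ‖B‖ₑ ^ 2 = ‖B'‖ₑ ^ 2 := by
  obtain ⟨w, b, -⟩ := exists_hilbertBasis ℂ (L2 d)
  rw [← h.tsum_enorm_sq b, ← h'.tsum_enorm_sq b]
  simp only [← ofReal_norm, hP]

/-- The distribution of the frequencies in the second variable depends only on `‖P f‖`. -/
theorem lintegral_fourier_snd_eq (h : HasKernel B P) (h' : HasKernel B' P')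
    (hP : ∀ f, ‖P f‖ = ‖P' f‖) {φ : Euc d → ℝ≥0∞} (hφ : Measurable φ) :
    ∫⁻ z, φ z.ofLp.2 * ‖(𝓕 B : L2Prod d) z‖ₑ ^ 2 = ∫⁻ z, φ z.ofLp.2 * ‖(𝓕 B' : L2Prod d) z‖ₑ ^ 2 := by
  have hm := (quasiMeasurePreserving_snd_ofLp d).measurable
  have hB : ∀ B : L2Prod d, AEMeasurable (fun z => ‖B z‖ₑ ^ 2) volume := fun B =>
    (Lp.aestronglyMeasurable B).enorm.pow_const _
  -- The integral depends only on the push-forward of `‖B z‖² dz` to the second variable, so it is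
  -- enough to compare these measures on sets.
  have hw : ∀ B : L2Prod d, ∫⁻ z, φ z.ofLp.2 * ‖B z‖ₑ ^ 2
      = ∫⁻ y, φ y ∂((volume.withDensity fun z => ‖B z‖ₑ ^ 2).map
          fun z : EucProd d => z.ofLp.2) := fun B => by
    rw [lintegral_map hφ hm]
    refine Eq.trans ?_ (lintegral_withDensity_eq_lintegral_mul₀ (hB B)
      (hφ.comp hm).aemeasurable).symm
    simp only [Pi.mul_apply, Function.comp_apply, mul_comm]
  rw [hw, hw]
  congr 1
  refine Measure.ext fun E hE => ?_
  rw [Measure.map_apply hm hE, Measure.map_apply hm hE, withDensity_apply _ (hm hE),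
    withDensity_apply _ (hm hE), ← enorm_indicatorLp_sq (measurableSet_snd_ofLp hE),
    ← enorm_indicatorLp_sq (measurableSet_snd_ofLp hE)]
  refine (h.fourier.indicatorLp hE).enorm_sq_eq (h'.fourier.indicatorLp hE) fun f => ?_
  rw [Lp.norm_fourier_eq, Lp.norm_fourier_eq, hP]

end HasKernel

/-! ### The kernel of `kernelOp` -/

section Kernel

variable {d : ℕ} {K : Euc d × Euc d → ℝ}

theorem coeFn_kernelLp (hK : MemLp K 2 volume) :
    kernelLp K hK =ᵐ[volume] fun z : EucProd d => (K z.ofLp : ℂ) :=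
  MemLp.coeFn_toLp _

/-- Fubini, justified because the product of two `L²` functions of `(x, y)` is integrable. -/
theorem hasKernel_kernelOp (hK : MemLp K 2 volume) :
    HasKernel (kernelLp K hK) (kernelOp K hK) := by
  intro f g
  have e : ∀ᵐ z : EucProd d, ⟪tensorLp f g z, kernelLp K hK z⟫_ℂ
      = (fun p : Euc d × Euc d => conj (f p.1) * ((K p : ℂ) * conj (g p.2))) z.ofLp := by
    filter_upwards [coeFn_tensorLp f g, coeFn_kernelLp hK] with z h1 h2
    rw [h1, h2, RCLike.inner_apply, map_mul]
    ring
  have hi := (integrable_congr e).1 (L2.integrable_inner (tensorLp f g) (kernelLp K hK))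
  rw [L2.inner_def, integral_congr_ae e, integral_eucProd, L2.inner_def]
  rw [integrable_eucProd_iff, Measure.volume_eq_prod] at hi
  rw [Measure.volume_eq_prod]
  refine (integral_prod _ hi).trans (integral_congr_ae ?_)
  filter_upwards [kernelOp_apply_ae K hK (star g)] with x hx
  rw [hx, RCLike.inner_apply, mul_comm, ← integral_const_mul]
  refine integral_congr_ae ?_
  filter_upwards [Lp.coeFn_star g] with y hy
  rw [hy]
  rfl

theorem star_kernelLp (hK : MemLp K 2 volume) : star (kernelLp K hK) = kernelLp K hK := by
  refine Lp.ext ?_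
  filter_upwards [Lp.coeFn_star (kernelLp K hK), coeFn_kernelLp hK] with z h1 h2
  rw [h1, Pi.star_apply, h2]
  exact Complex.conj_ofReal _

theorem swapLp_kernelLp_eq_iff (hK : MemLp K 2 volume) :
    swapLp (kernelLp K hK) = kernelLp K hK ↔ IsSymmKernel K := by
  have hs := (measurePreserving_swap_eucProd d).quasiMeasurePreserving.ae (coeFn_kernelLp hK)
  constructor
  · intro h
    have : ∀ᵐ z : EucProd d, K z.ofLp = K z.ofLp.swap := by
      filter_upwards [coeFn_swapLp (kernelLp K hK), coeFn_kernelLp hK, hs] with z h1 h2 h3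
      rw [h, h2, h3] at h1
      exact Complex.ofReal_injective h1
    exact (WithLp.volume_preserving_toLp (Euc d) (Euc d)).quasiMeasurePreserving.ae this
  · intro h
    refine Lp.ext ?_
    filter_upwards [coeFn_swapLp (kernelLp K hK), coeFn_kernelLp hK, hs,
      (WithLp.volume_preserving_ofLp (Euc d) (Euc d)).quasiMeasurePreserving.ae h] with z h1 h2 h3 h4
    rw [h1, h2, h3, h4]

theorem star_kernelOp_star (hK : MemLp K 2 volume) (g : L2 d) :
    star (kernelOp K hK (star g)) = kernelOp K hK g := by
  have h := (hasKernel_kernelOp hK).star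
  rw [star_kernelLp] at h
  exact congrFun (h.map_unique (hasKernel_kernelOp hK)) g

theorem adjoint_kernelOp (hK : MemLp K 2 volume) (hS : IsSymmKernel K) :
    ContinuousLinearMap.adjoint (kernelOp K hK) = kernelOp K hK := by
  have h := (hasKernel_kernelOp hK).swapLp
  rw [(swapLp_kernelLp_eq_iff hK).2 hS] at h
  ext1 g
  have := congrFun (h.map_unique (hasKernel_kernelOp hK)) (star g)
  simp only [star_star] at this
  rw [← star_kernelOp_star, ← this, star_star]

theorem isSymmKernel_of_adjoint_kernelOp (hK : MemLp K 2 volume)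
    (h : ContinuousLinearMap.adjoint (kernelOp K hK) = kernelOp K hK) : IsSymmKernel K := by
  refine (swapLp_kernelLp_eq_iff hK).1 ?_
  have h' := (hasKernel_kernelOp hK).swapLp
  simp only [h, star_kernelOp_star] at h'
  exact h'.kernel_unique (hasKernel_kernelOp hK)

end Kernel

/-! ### Existence of kernels -/

/-- The kernel is `∑ P (conj b_j) ⊗ b_j`; its terms are mutually orthogonal, so it converges exactly
when the squared norms are summable. -/
theorem exists_hasKernel {d : ℕ} (P : L2 d →L[ℂ] L2 d) {ι : Type*} (b : HilbertBasis ι ℂ (L2 d))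
    (hP : ∑' j, ‖P (star (b j))‖ₑ ^ 2 ≠ ∞) : ∃ B : L2Prod d, HasKernel B P := by
  classical
  have hsum : Summable fun j => ‖P (star (b j))‖ ^ 2 := by
    have := ENNReal.summable_toReal hP
    simpa using this
  let V : ι → L2 d →ₗᵢ[ℂ] L2Prod d := fun j =>
    { toLinearMap := ((tensorCLM d).flip (b j)).toLinearMap
      norm_map' := fun f => by
        change ‖tensorLp f (b j)‖ = ‖f‖
        rw [norm_tensorLp, b.orthonormal.1, mul_one] }
  have hV : ∀ j f, V j f = tensorLp f (b j) := fun _ _ => rfl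
  have hO : OrthogonalFamily ℂ (fun _ : ι => L2 d) V := by
    intro i j hij f g
    change ⟪tensorLp f (b i), tensorLp g (b j)⟫_ℂ = 0
    rw [inner_tensorLp_tensorLp, b.orthonormal.2 hij, mul_zero]
  have hS : Summable fun j => V j (P (star (b j))) :=
    (hO.summable_iff_norm_sq_summable _).2 hsum
  refine ⟨∑' j, V j (P (star (b j))), fun f => ?_⟩
  set B := ∑' j, V j (P (star (b j)))
  have h1 : ∀ m, ⟪tensorLp f (b m), B⟫_ℂ = ⟪f, P (star (b m))⟫_ℂ := by
    intro m
    refine ((innerSL ℂ (tensorLp f (b m))).map_tsum hS).trans ?_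
    simp only [innerSL_apply_apply, hV, inner_tensorLp_tensorLp,
      orthonormal_iff_ite.1 b.orthonormal]
    rw [tsum_eq_single m]
    · simp
    · intro j hj
      simp [hj.symm]
  -- Passing from basis vectors to arbitrary `g`: for fixed `f`, both sides of the kernel identity
  -- are inner products of `g` with fixed vectors, and these have equal coefficients.
  have h2 : ContinuousLinearMap.adjoint (tensorCLM d f) B
      = star (ContinuousLinearMap.adjoint P f) := by
    refine b.ext_inner fun m => ?_
    rw [ContinuousLinearMap.adjoint_inner_right, tensorCLM_apply, h1, inner_star_right,
      ContinuousLinearMap.adjoint_inner_right, inner_conj_symm]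
  intro g
  rw [← tensorCLM_apply, ← ContinuousLinearMap.adjoint_inner_right, h2, inner_star_right,
    ContinuousLinearMap.adjoint_inner_right, inner_conj_symm]

/-- Commuting with conjugation forces `B` to be real almost everywhere, by uniqueness of kernels, so
its real part serves as `A`. -/
theorem exists_kernelOp_eq {d : ℕ} {P : L2 d →L[ℂ] L2 d} {B : L2Prod d} (h : HasKernel B P)
    (hP : ∀ g, star (P (star g)) = P g) :
    ∃ (A : Euc d × Euc d → ℝ) (hA : MemLp A 2 volume), kernelOp A hA = P := by
  have hB : star B = B := by
    have h' := h.star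
    simp only [hP] at h'
    exact h'.kernel_unique h
  have hA : MemLp (fun p : Euc d × Euc d => (B (WithLp.toLp 2 p)).re) 2 volume :=
    ((Lp.memLp B).comp_measurePreserving (WithLp.volume_preserving_toLp (Euc d) (Euc d))).re
  refine ⟨_, hA, ?_⟩
  have hAB : kernelLp _ hA = B := by
    refine Lp.ext ?_
    filter_upwards [coeFn_kernelLp hA, Lp.coeFn_star B] with z h1 h2
    rw [hB, Pi.star_apply] at h2
    rw [h1]
    exact Complex.conj_eq_iff_re.1 h2.symm
  have h' := hasKernel_kernelOp hA
  rw [hAB] at h'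
  exact DFunLike.coe_injective (h'.map_unique h)

/-! ### The absolute value -/

section Abs

theorem operatorAbs_nonneg {H : Type*} [NormedAddCommGroup H] [InnerProductSpace ℂ H]
    [CompleteSpace H] (T : H →L[ℂ] H) : 0 ≤ operatorAbs T :=
  CFC.abs_nonneg T

theorem operatorAbs_apply_operatorAbs {H : Type*} [NormedAddCommGroup H] [InnerProductSpace ℂ H]
    [CompleteSpace H] (T : H →L[ℂ] H) (f : H) :
    operatorAbs T (operatorAbs T f) = ContinuousLinearMap.adjoint T (T f) :=
  congrArg (fun S : H →L[ℂ] H => S f) (CFC.abs_mul_abs T)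

theorem operatorAbs_unique {H : Type*} [NormedAddCommGroup H] [InnerProductSpace ℂ H]
    [CompleteSpace H] {T R : H →L[ℂ] H} (hR : 0 ≤ R)
    (h : ∀ f, R (R f) = ContinuousLinearMap.adjoint T (T f)) : operatorAbs T = R :=
  CFC.sqrt_unique (show R * R = star T * T from ContinuousLinearMap.ext h) hR

theorem adjoint_operatorAbs {H : Type*} [NormedAddCommGroup H] [InnerProductSpace ℂ H]
    [CompleteSpace H] (T : H →L[ℂ] H) :
    ContinuousLinearMap.adjoint (operatorAbs T) = operatorAbs T :=
  (IsSelfAdjoint.of_nonneg (operatorAbs_nonneg T)).star_eq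

variable {d : ℕ} (T : L2 d →L[ℂ] L2 d)

/-- Both squares equal `⟪f, T* T f⟫`. -/
theorem norm_operatorAbs_apply (f : L2 d) : ‖operatorAbs T f‖ = ‖T f‖ := by
  have h2 : ⟪operatorAbs T f, operatorAbs T f⟫_ℂ = ⟪T f, T f⟫_ℂ := by
    rw [← ContinuousLinearMap.adjoint_inner_right, adjoint_operatorAbs, operatorAbs_apply_operatorAbs,
      ContinuousLinearMap.adjoint_inner_right]
  rw [← sq_eq_sq₀ (norm_nonneg _) (norm_nonneg _), ← inner_self_eq_norm_sq (𝕜 := ℂ), h2,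
    inner_self_eq_norm_sq]

/-- The conjugate `f ↦ conj (T (conj f))` of an operator. -/
def conjOp : L2 d →L[ℂ] L2 d :=
  LinearMap.mkContinuous
    { toFun := fun f => star (T (star f))
      map_add' := fun f g => by rw [star_add_Lp, map_add, star_add_Lp]
      map_smul' := fun c f => by
        rw [star_smul_Lp, map_smul, star_smul_Lp, Complex.conj_conj, RingHom.id_apply] }
    ‖T‖ (fun f => by
      change ‖star (T (star f))‖ ≤ ‖T‖ * ‖f‖
      rw [norm_star_Lp, ← norm_star_Lp f]
      exact T.le_opNorm _)

theorem conjOp_apply (f : L2 d) : conjOp T f = star (T (star f)) := rfl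

variable {T}

theorem conjOp_nonneg (hT : 0 ≤ T) : 0 ≤ conjOp T := by
  rw [ContinuousLinearMap.nonneg_iff_isPositive, ContinuousLinearMap.isPositive_iff_complex] at hT ⊢
  intro x
  obtain ⟨h1, h2⟩ := hT (star x)
  rw [conjOp_apply, inner_star_left, ← h1]
  simp only [Complex.conj_ofReal]
  simpa using h2

/-- The conjugate of `|T|` is again positive and squares to the conjugate of `T²`, which is `T²`;
the positive square root is unique. -/
theorem star_operatorAbs_star (hT : ∀ g, star (T (star g)) = T g)
    (hT' : ContinuousLinearMap.adjoint T = T) (g : L2 d) :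
    star (operatorAbs T (star g)) = operatorAbs T g := by
  rw [← conjOp_apply]
  refine (congrArg (fun S : L2 d →L[ℂ] L2 d => S g)
    (operatorAbs_unique (conjOp_nonneg (operatorAbs_nonneg T)) fun f => ?_)).symm
  rw [conjOp_apply, conjOp_apply, star_star, operatorAbs_apply_operatorAbs, hT', ← hT (T f),
    ← hT f, star_star]

end Abs

theorem exists_kernelOp_eq_operatorAbs {d : ℕ} {K : Euc d × Euc d → ℝ} (hK : MemLp K 2 volume)
    (hS : IsSymmKernel K) : ∃ (A : Euc d × Euc d → ℝ) (hA : MemLp A 2 volume),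
      kernelOp A hA = operatorAbs (kernelOp K hK) := by
  obtain ⟨w, b, -⟩ := exists_hilbertBasis ℂ (L2 d)
  obtain ⟨B, hB⟩ := exists_hasKernel (operatorAbs (kernelOp K hK)) b (by
    simp only [← ofReal_norm, norm_operatorAbs_apply]
    simp only [ofReal_norm, (hasKernel_kernelOp hK).tsum_enorm_sq b]
    exact ENNReal.pow_ne_top enorm_ne_top)
  exact exists_kernelOp_eq hB
    (star_operatorAbs_star (star_kernelOp_star hK) (adjoint_kernelOp hK hS))

/-! ### Sobolev norms -/

/-- Connects the distributional definition with the weighted integral: the distribution `w s · 𝓕 B`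
is an `L²` function exactly when the pointwise product is. -/
theorem memSobolev_toTemperedDistribution_iff {E : Type*} [NormedAddCommGroup E]
    [InnerProductSpace ℝ E] [FiniteDimensional ℝ E] [MeasurableSpace E] [BorelSpace E] {s : ℝ}
    (hs : 0 ≤ s) (B : Lp ℂ 2 (volume : Measure E)) :
    TemperedDistribution.MemSobolev s 2 (B : 𝓢'(E, ℂ)) ↔
      ∫⁻ ζ, ENNReal.ofReal ((1 + ‖ζ‖ ^ 2) ^ s)
        * ‖(𝓕 B : Lp ℂ 2 (volume : Measure E)) ζ‖ₑ ^ 2 < ∞ := by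
  set G : Lp ℂ 2 (volume : Measure E) := 𝓕 B with hG
  set w : ℝ → E → ℂ := fun r ζ => ((1 + ‖ζ‖ ^ 2) ^ (r / 2) : ℝ) with hw
  have hwg : ∀ r, (w r).HasTemperateGrowth := fun r => by
    simp only [hw]
    fun_prop
  have hpos : ∀ ζ : E, 0 < 1 + ‖ζ‖ ^ 2 := fun ζ => by positivity
  have hww : ∀ r, w r * w (-r) = fun _ => 1 := fun r => by
    funext ζ
    simp only [hw, Pi.mul_apply]
    rw [← Complex.ofReal_mul, ← Real.rpow_add (hpos ζ)]
    simp [neg_div]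
  have hwn : ∀ ζ, ENNReal.ofReal ((1 + ‖ζ‖ ^ 2) ^ s) = ‖w s ζ‖ₑ ^ 2 := fun ζ => by
    rw [← ofReal_norm, ← ENNReal.ofReal_pow (norm_nonneg _)]
    simp only [hw, Complex.norm_real, Real.norm_eq_abs, sq_abs]
    rw [← Real.rpow_mul_natCast (hpos ζ).le]
    norm_num
  have hwb : MemLp (w (-s)) ∞ (volume : Measure E) := by
    refine memLp_top_of_bound (hwg _).1.continuous.aestronglyMeasurable 1
      (Filter.Eventually.of_forall fun ζ => ?_)
    simp only [hw, Complex.norm_real, Real.norm_eq_abs]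
    rw [abs_of_nonneg (Real.rpow_nonneg (hpos ζ).le _)]
    exact Real.rpow_le_one_of_one_le_of_nonpos (by simp) (by linarith)
  have hinj : ∀ f g : Lp ℂ 2 (volume : Measure E), (f : 𝓢'(E, ℂ)) = g → f = g := fun f g h =>
    LinearMap.ker_eq_bot.1 (Lp.ker_toTemperedDistributionCLM_eq_bot (F := ℂ) (μ := volume)
      (p := 2)) h
  have key : ∀ f : Lp ℂ 2 (volume : Measure E),
      TemperedDistribution.smulLeftCLM ℂ (w s) (G : 𝓢'(E, ℂ)) = f ↔
        f =ᵐ[volume] fun ζ => w s ζ * G ζ := by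
    intro f
    -- The weight `w s` may be unbounded, so it is moved to the other side as `w (-s)`. This is
    -- bounded since `s ≥ 0`, and multiplication by it acts within `L²`.
    have e1 : TemperedDistribution.smulLeftCLM ℂ (w s) (G : 𝓢'(E, ℂ)) = f ↔
        (G : 𝓢'(E, ℂ)) = TemperedDistribution.smulLeftCLM ℂ (w (-s)) f := by
      constructor
      · intro h
        rw [← h, TemperedDistribution.smulLeftCLM_smulLeftCLM_apply (hwg _) (hwg _), hww]
        simp
      · intro h
        rw [h, TemperedDistribution.smulLeftCLM_smulLeftCLM_apply (hwg _) (hwg _), mul_comm, hww]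
        simp
    rw [e1, ← Lp.toTemperedDistribution_smul_eq (r := 2) (hwg _) hwb f]
    have e2 := (Lp.coeFn_lpSMul (r := 2) (hwb.toLp _) f)
    have hw1 : ∀ ζ, w s ζ * w (-s) ζ = 1 := fun ζ => congrFun (hww s) ζ
    constructor
    · intro h
      have h' := hinj _ _ h
      rw [← h'] at e2
      filter_upwards [e2, hwb.coeFn_toLp] with ζ h1 h2
      rw [h1, Pi.smul_apply', h2, smul_eq_mul, ← mul_assoc, hw1, one_mul]
    · intro h
      refine congrArg _ (Lp.ext ?_)
      filter_upwards [e2, hwb.coeFn_toLp, h] with ζ h1 h2 h3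
      rw [h1, Pi.smul_apply', h2, h3, smul_eq_mul, ← mul_assoc, mul_comm (w (-s) ζ), hw1, one_mul]
  rw [TemperedDistribution.memSobolev_iff_exists_smulLeftCLM_fourier,
    Lp.fourier_toTemperedDistribution_eq]
  simp only [hwn, ← mul_pow, ← enorm_mul]
  have hm : AEStronglyMeasurable (fun ζ => w s ζ * G ζ) volume :=
    (hwg s).1.continuous.aestronglyMeasurable.mul (Lp.aestronglyMeasurable G)
  have hL : ∫⁻ ζ, ‖w s ζ * G ζ‖ₑ ^ 2 < ∞ ↔ MemLp (fun ζ => w s ζ * G ζ) 2 volume := by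
    rw [MemLp, and_iff_right hm,
      eLpNorm_lt_top_iff_lintegral_rpow_enorm_lt_top (by norm_num) (by norm_num)]
    simp
  rw [hL]
  constructor
  · rintro ⟨f, hf⟩
    exact (memLp_congr_ae ((key f).1 hf)).1 (Lp.memLp f)
  · intro h
    exact ⟨h.toLp _, (key _).2 h.coeFn_toLp⟩

theorem kernelMemSobolev_iff {d : ℕ} {s : ℝ} (hs : 0 ≤ s) {K : Euc d × Euc d → ℝ}
    (hK : MemLp K 2 volume) : KernelMemSobolev s K hK ↔ kernelSobolevNorm s K hK < ∞ := by
  rw [KernelMemSobolev, memSobolev_toTemperedDistribution_iff hs, kernelSobolevNorm,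
    ENNReal.rpow_lt_top_iff_of_pos (by norm_num)]

theorem norm_sq_eucProd {d : ℕ} (z : EucProd d) : ‖z‖ ^ 2 = ‖z.ofLp.1‖ ^ 2 + ‖z.ofLp.2‖ ^ 2 :=
  WithLp.prod_norm_sq_eq_of_L2 z

theorem one_add_add_rpow_le {s a b : ℝ} (hs : 0 ≤ s) (ha : 0 ≤ a) (hb : 0 ≤ b) :
    (1 + (a + b)) ^ s ≤ 2 ^ s * ((1 + a) ^ s + (1 + b) ^ s) := by
  wlog h : a ≤ b generalizing a b
  · rw [add_comm a, add_comm ((1 + a) ^ s)]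
    exact this hb ha (le_of_not_ge h)
  -- With `b` the larger of the two, `1 + a + b ≤ 2 (1 + b)`.
  calc (1 + (a + b)) ^ s ≤ (2 * (1 + b)) ^ s :=
        Real.rpow_le_rpow (by positivity) (by linarith) hs
    _ = 2 ^ s * (1 + b) ^ s := Real.mul_rpow (by norm_num) (by positivity)
    _ ≤ _ := by
      gcongr
      exact le_add_of_nonneg_left (by positivity)

theorem lintegral_swap_eucProd {d : ℕ} (f : EucProd d → ℝ≥0∞) :
    ∫⁻ z : EucProd d, f (WithLp.toLp 2 z.ofLp.swap) = ∫⁻ z, f z :=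
  (measurePreserving_swap_eucProd d).lintegral_comp_emb
    (((MeasurableEquiv.toLp 2 (Euc d × Euc d)).symm.trans MeasurableEquiv.prodComm).trans
      (MeasurableEquiv.toLp 2 (Euc d × Euc d))).measurableEmbedding f

/-- If the modulus of `G` is symmetric, then the weight `(1 + ‖(x, y)‖²)^s` can be replaced by
the weight `(1 + ‖y‖²)^s`. -/
theorem lintegral_weight_le {d : ℕ} {s : ℝ} (hs : 0 ≤ s) {G : L2Prod d} (hG : swapLp G = G) :
    ∫⁻ z, ENNReal.ofReal ((1 + ‖z‖ ^ 2) ^ s) * ‖G z‖ₑ ^ 2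
      ≤ ENNReal.ofReal (2 ^ (s + 1)) *
        ∫⁻ z, ENNReal.ofReal ((1 + ‖z.ofLp.2‖ ^ 2) ^ s) * ‖G z‖ₑ ^ 2 := by
  have hG2 : AEMeasurable (fun z => ‖G z‖ₑ ^ 2) volume :=
    (Lp.aestronglyMeasurable G).enorm.pow_const _
  have hφ : Measurable fun y : Euc d => ENNReal.ofReal ((1 + ‖y‖ ^ 2) ^ s) := by fun_prop
  set J := ∫⁻ z, ENNReal.ofReal ((1 + ‖z.ofLp.2‖ ^ 2) ^ s) * ‖G z‖ₑ ^ 2 with hJ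
  -- Symmetry enters here: both variables contribute the same integral, which turns `2 ^ s` into `2
  -- ^ (s + 1)`.
  have hswap : ∫⁻ z, ENNReal.ofReal ((1 + ‖z.ofLp.1‖ ^ 2) ^ s) * ‖G z‖ₑ ^ 2 = J := by
    rw [hJ, ← lintegral_swap_eucProd]
    refine lintegral_congr_ae ?_
    filter_upwards [coeFn_swapLp G] with z hz
    rw [← hz, hG]
    rfl
  calc ∫⁻ z, ENNReal.ofReal ((1 + ‖z‖ ^ 2) ^ s) * ‖G z‖ₑ ^ 2
      ≤ ∫⁻ z, ENNReal.ofReal (2 ^ s) * (ENNReal.ofReal ((1 + ‖z.ofLp.1‖ ^ 2) ^ s) * ‖G z‖ₑ ^ 2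
          + ENNReal.ofReal ((1 + ‖z.ofLp.2‖ ^ 2) ^ s) * ‖G z‖ₑ ^ 2) := by
        refine lintegral_mono fun z => ?_
        rw [← add_mul, ← mul_assoc, ← ENNReal.ofReal_add (by positivity) (by positivity),
          ← ENNReal.ofReal_mul (by positivity), norm_sq_eucProd]
        gcongr
        exact one_add_add_rpow_le hs (by positivity) (by positivity)
    _ = ENNReal.ofReal (2 ^ s) * (J + J) := by
        rw [lintegral_const_mul' _ _ ENNReal.ofReal_ne_top, lintegral_add_left' (by
          exact (hφ.comp (quasiMeasurePreserving_fst_ofLp d).measurable).aemeasurable.mul hG2),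
          hswap]
    _ = _ := by
        rw [Real.rpow_add_one two_ne_zero, ENNReal.ofReal_mul (by positivity), ← two_mul,
          ← mul_assoc]
        norm_num

theorem kernelSobolevNorm_le_of_norm_kernelOp_eq {d : ℕ} {s : ℝ} (hs : 0 ≤ s)
    {K A : Euc d × Euc d → ℝ} (hK : MemLp K 2 volume) (hA : MemLp A 2 volume)
    (hS : IsSymmKernel A) (h : ∀ f, ‖kernelOp A hA f‖ = ‖kernelOp K hK f‖) :
    kernelSobolevNorm s A hA ≤ ((2 ^ (s + 1)) ^ (1 / 2 : ℝ) : ℝ≥0) * kernelSobolevNorm s K hK := by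
  have hG : swapLp (𝓕 (kernelLp A hA)) = 𝓕 (kernelLp A hA) := by
    rw [← fourier_swapLp, (swapLp_kernelLp_eq_iff hA).2 hS]
  have hφ : Measurable fun y : Euc d => ENNReal.ofReal ((1 + ‖y‖ ^ 2) ^ s) := by fun_prop
  have h1 := lintegral_weight_le hs hG
  rw [(hasKernel_kernelOp hA).lintegral_fourier_snd_eq (hasKernel_kernelOp hK) h hφ] at h1
  have hc : ENNReal.ofReal (2 ^ (s + 1)) = ((2 ^ (s + 1) : ℝ≥0) : ℝ≥0∞) := by
    rw [← ENNReal.ofReal_coe_nnreal]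
    norm_num
  rw [ENNReal.coe_rpow_of_nonneg _ (by norm_num), ← hc]
  unfold kernelSobolevNorm
  rw [← ENNReal.mul_rpow_of_nonneg _ _ (by norm_num)]
  gcongr
  -- The `η`-integral now belongs to `K`; it remains to enlarge its weight to the full one.
  refine h1.trans ?_
  gcongr with z
  rw [← sq_le_sq₀ (norm_nonneg _) (norm_nonneg _), norm_sq_eucProd]
  exact le_add_of_nonneg_left (by positivity)

end

theorem mainTheorem9 (s : ℝ) (hs : 0 < s) :
    ∃ C : ℝ≥0, ∀ (d : ℕ) (K : Euc d × Euc d → ℝ) (hK : MemLp K 2 volume),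
      IsSymmKernel K → KernelMemSobolev s K hK →
        (∃ (A : Euc d × Euc d → ℝ) (hA : MemLp A 2 volume),
          kernelOp A hA = operatorAbs (kernelOp K hK)) ∧
        ∀ (A : Euc d × Euc d → ℝ) (hA : MemLp A 2 volume),
          kernelOp A hA = operatorAbs (kernelOp K hK) →
            IsSymmKernel A ∧ KernelMemSobolev s A hA ∧
            kernelSobolevNorm s A hA ≤ C * kernelSobolevNorm s K hK ∧
            kernelSobolevNorm s K hK ≤ C * kernelSobolevNorm s A hA := by
  -- The square root undoes the squaring of the norm in the weighted comparison.
  refine ⟨(2 ^ (s + 1)) ^ (1 / 2 : ℝ), fun d K hK hS hKs =>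
    ⟨exists_kernelOp_eq_operatorAbs hK hS, fun A hA hAK => ?_⟩⟩
  have hSA : IsSymmKernel A :=
    isSymmKernel_of_adjoint_kernelOp hA (by rw [hAK]; exact adjoint_operatorAbs _)
  have hn : ∀ f, ‖kernelOp A hA f‖ = ‖kernelOp K hK f‖ := fun f => by
    rw [hAK, norm_operatorAbs_apply]
  have hAle := kernelSobolevNorm_le_of_norm_kernelOp_eq hs.le hK hA hSA hn
  -- The reverse inequality is the same lemma with `A` and `K` interchanged, using the symmetry of
  -- `K`.
  refine ⟨hSA, ?_, hAle,
    kernelSobolevNorm_le_of_norm_kernelOp_eq hs.le hA hK hS fun f => (hn f).symm⟩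
  rw [kernelMemSobolev_iff hs.le] at hKs ⊢
  exact hAle.trans_lt (ENNReal.mul_lt_top ENNReal.coe_lt_top hKs)
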